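/- Conventions. Rings are commutative with unity, $I=[0,1]$, and $H^*(-;R)$ denotes Alexander--Spanier cohomology with its cup product. Let $p\colon E\to B$ be a Hurewicz fibration, where $E$ is a metric space, and let $r\ge 2$. Put $E^r_B=\{(e_1,\dots,e_r)\in E^r \mid p(e_i)=p(e_j)\text{ for all } i,j\}$, with diagonal map $\Delta_r\colon E\to E^r_B$, $e\mapsto(e,\dots,e)$. Let $E^I_B$ be the space, with the uniform metric (equivalently, the compact-open topology), of those paths $\gamma\colon I\to E$ for which $p\circ\gamma$ is constant. For a metric space $X$, let $\mathcal B_k(X)$ be the space of probability measures on $X$ supported on at most $k$ points, with the topology of the Lévy--Prokhorov metric. The $r$-th sequential parametrized distributional complexity $\mathrm{dTC}_r[p\colon E\to B]$ is the smallest integer $m\ge 0$ for which there is a continuous map $s\colon E^r_B\to\mathcal B_{m+1}(E^I_B)$ such that, for every $(e_1,\dots,e_r)\in E^r_B$, each path $\gamma$ in the support of $s(e_1,\dots,e_r)$ satisfies $\gamma\left(\frac{i-1}{r-1}\right)=e_i$ for $1\le i\le r$ (and it is $\infty$ if there is no such $m$). For a space $X$, let $SP^k(X)=X^k/S_k$ be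 the $k$-th symmetric product with the quotient topology, and let $\delta_k\colon E^r_B\to SP^k(E^r_B)$, $x\mapsto[x,\dots,x]$, be the diagonal map. Theorem. Let $n\ge 1$ be an integer and $R$ a ring. (1) Let $k_1,\dots,k_n\ge 1$, let $\alpha_i^*\in H^{k_i}(SP^{n!}(E^r_B);R)$ for $1\le i\le n$, and put $\alpha_i=\delta_{n!}^*(\alpha_i^*)\in H^{k_i}(E^r_B;R)$. If $\Delta_r^*(\alpha_i)=0$ for all $i$ and $\alpha_1\alpha_2\cdots\alpha_n\neq 0$, then $\mathrm{dTC}_r[p\colon E\to B]\ge n$. (2) In other words, if $c\ell_R\left(\mathrm{Im}(\delta_{n!}^*)\cap\mathrm{Ker}(\Delta_r^*)\right)\ge n$, then $\mathrm{dTC}_r[p\colon E\to B]\ge n$. Here $\delta_{n!}^*\colon H^*(SP^{n!}(E^r_B);R)\to H^*(E^r_B;R)$ and $\Delta_r^*\colon H^*(E^r_B;R)\to H^*(E;R)$ are the induced ring homomorphisms, and the cup-length $c\ell_R(S)$ of a subset $S$ of a cohomology ring is the supremum of the lengths of non-zero products of homogeneous positive-degree elements of $S$. -/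

import Mathlib

open Topology MeasureTheory unitInterval

universe u v w

/-! ### Alexander–Spanier cohomology -/

namespace AlexanderSpanier

section Cochains

variable (R : Type w) [CommRing R] (X : Type u)

/-- Alexander–Spanier `q`-cochains before localisation: all functions `X^{q+1} → R`. -/
abbrev Cochain (q : ℕ) : Type (max u w) := (Fin (q + 1) → X) → R

/-- The coboundary `(d f)(x₀, …, x_{q+1}) = ∑ᵢ (-1)ⁱ f(x₀, …, x̂ᵢ, …, x_{q+1})`. -/
def d (q : ℕ) : Cochain R X q →ₗ[R] Cochain R X (q + 1) where
  toFun f x := ∑ i : Fin (q + 2), (-1 : R) ^ (i : ℕ) * f (fun j => x (i.succAbove j))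
  map_add' f g := by
    funext x
    simp [mul_add, Finset.sum_add_distrib]
  map_smul' c f := by
    funext x
    simp [Finset.mul_sum, mul_left_comm]

variable {R X}

/-- The cup product of cochains,
`(f ⌣ g)(x₀, …, x_{p+q}) = f(x₀, …, x_p) g(x_p, …, x_{p+q})`. -/
def cupCochain {p q : ℕ} (f : Cochain R X p) (g : Cochain R X q) : Cochain R X (p + q) :=
  fun x => f (fun i : Fin (p + 1) => x ⟨i, by omega⟩) *
    g (fun j : Fin (q + 1) => x ⟨p + j, by omega⟩)

/-- The first `n + 1` terms of a sequence; a device for the proofs below. -/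
def res (n : ℕ) (y : ℕ → X) : Fin (n + 1) → X := fun i => y i

/-- The sequence `y` with its `i`-th term omitted. -/
def omitTerm (i : ℕ) (y : ℕ → X) : ℕ → X := fun j => if j < i then y j else y (j + 1)

theorem exists_res {n : ℕ} (x : Fin (n + 1) → X) :
    ∃ y : ℕ → X, res n y = x ∧ ∀ i, ∃ j, y i = x j := by
  refine ⟨fun i => if h : i < n + 1 then x ⟨i, h⟩ else x 0, ?_, ?_⟩
  · funext i
    simp only [res]
    rw [dif_pos i.2]
  · intro i
    by_cases h : i < n + 1
    · exact ⟨⟨i, h⟩, by simp [h]⟩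
    · exact ⟨0, by simp [h]⟩

theorem d_res {q : ℕ} (f : Cochain R X q) (y : ℕ → X) :
    d R X q f (res (q + 1) y) =
      ∑ i ∈ Finset.range (q + 2), (-1 : R) ^ i * f (res q (omitTerm i y)) := by
  rw [Finset.sum_range]
  change ∑ i : Fin (q + 2), (-1 : R) ^ (i : ℕ) * f (fun j => res (q + 1) y (i.succAbove j)) = _
  refine Finset.sum_congr rfl fun i _ => ?_
  congr 2
  funext j
  simp only [res, omitTerm, Fin.succAbove, Fin.lt_def, Fin.val_castSucc]
  split_ifs <;> simp

theorem cup_res {p q : ℕ} (f : Cochain R X p) (g : Cochain R X q) (y : ℕ → X) :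
    cupCochain f g (res (p + q) y) = f (res p y) * g (res q (fun j => y (p + j))) := rfl

theorem d_cup_res {p q : ℕ} (f : Cochain R X p) (g : Cochain R X q) (y : ℕ → X) :
    d R X (p + q) (cupCochain f g) (res (p + q + 1) y) =
      d R X p f (res (p + 1) y) * g (res q (fun j => y (p + 1 + j))) +
      (-1) ^ p * (f (res p y) * d R X q g (res (q + 1) (fun j => y (p + j)))) := by
  simp only [d_res, cup_res]
  have e : p + q + 2 = (p + 1) + (q + 1) := by omega
  rw [e, Finset.sum_range_add, Finset.sum_range_succ _ (p + 1), Finset.sum_range_succ' _ (q + 1)]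
  have h1 : ∀ i ∈ Finset.range (p + 1),
      (-1 : R) ^ i * (f (res p (omitTerm i y)) * g (res q fun j => omitTerm i y (p + j))) =
      (-1 : R) ^ i * f (res p (omitTerm i y)) * g (res q fun j => y (p + 1 + j)) := by
    intro i hi
    have hi := Finset.mem_range.1 hi
    have : (fun j => omitTerm i y (p + j)) = fun j => y (p + 1 + j) := by
      funext j
      simp only [omitTerm]
      rw [if_neg (by omega)]
      congr 1
      omega
    rw [this, mul_assoc]
  have h2 : ∀ j ∈ Finset.range (q + 1),
      (-1 : R) ^ (p + 1 + j) * (f (res p (omitTerm (p + 1 + j) y)) *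
        g (res q fun k => omitTerm (p + 1 + j) y (p + k))) =
      (-1) ^ p * (f (res p y) *
        ((-1 : R) ^ (j + 1) * g (res q (omitTerm (j + 1) fun k => y (p + k))))) := by
    intro j _
    have e1 : res p (omitTerm (p + 1 + j) y) = res p y := by
      funext k
      have := k.2
      simp only [res, omitTerm]
      rw [if_pos (by omega)]
    have e2 : (fun k => omitTerm (p + 1 + j) y (p + k)) = omitTerm (j + 1) fun k => y (p + k) := by
      funext k
      simp only [omitTerm]
      by_cases h : k < j + 1
      · rw [if_pos h, if_pos (by omega)]
      · rw [if_neg h, if_neg (by omega)]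
        congr 1
    rw [e1, e2]
    ring
  rw [Finset.sum_congr rfl h1, Finset.sum_congr rfl h2, ← Finset.sum_mul, ← Finset.mul_sum,
    ← Finset.mul_sum]
  have e3 : res p (omitTerm (p + 1) y) = res p y := by
    funext k
    have := k.2
    simp only [res, omitTerm]
    rw [if_pos (by omega)]
  have e4 : (omitTerm 0 fun k => y (p + k)) = fun k => y (p + 1 + k) := by
    funext k
    simp only [omitTerm]
    rw [if_neg (by omega)]
    congr 1
    omega
  rw [e3, e4]
  ring

end Cochains

section Cohomology

variable (R : Type w) [CommRing R] (X : Type u) [TopologicalSpace X]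

/-- The locally zero cochains: those `f` for which there is an open cover of `X` such that `f`
vanishes on `U^{q+1}` for every member `U` of the cover. -/
def locallyZero (q : ℕ) : Submodule R (Cochain R X q) where
  carrier := {f | ∀ a : X, ∃ U ∈ 𝓝 a, ∀ x : Fin (q + 1) → X, (∀ i, x i ∈ U) → f x = 0}
  zero_mem' := fun _ => ⟨Set.univ, Filter.univ_mem, fun _ _ => rfl⟩
  add_mem' := by
    intro f g hf hg a
    obtain ⟨U, hU, hU'⟩ := hf a
    obtain ⟨V, hV, hV'⟩ := hg a
    refine ⟨U ∩ V, Filter.inter_mem hU hV, fun x hx => ?_⟩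
    simp [hU' x fun i => (hx i).1, hV' x fun i => (hx i).2]
  smul_mem' := by
    intro c f hf a
    obtain ⟨U, hU, hU'⟩ := hf a
    exact ⟨U, hU, fun x hx => by simp [hU' x hx]⟩

/-- Cochains that represent a cocycle of the quotient complex
`Cochain / locallyZero`: those whose coboundary is locally zero. -/
def cocycles (q : ℕ) : Submodule R (Cochain R X q) :=
  (locallyZero R X (q + 1)).comap (d R X q)

/-- Cochains that represent a coboundary of the quotient complex `Cochain / locallyZero`. -/
def coboundaries : (q : ℕ) → Submodule R (Cochain R X q)
  | 0 => locallyZero R X 0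
  | q + 1 => locallyZero R X (q + 1) ⊔ LinearMap.range (d R X q)

/-- Alexander–Spanier cohomology `H^q(X; R)`: the cohomology of the complex
`Cochain / locallyZero`, as cocycle representatives modulo coboundary representatives. -/
def Cohomology (q : ℕ) : Type (max u w) :=
  cocycles R X q ⧸ (coboundaries R X q).comap (cocycles R X q).subtype

instance (q : ℕ) : AddCommGroup (Cohomology R X q) :=
  inferInstanceAs (AddCommGroup
    (cocycles R X q ⧸ (coboundaries R X q).comap (cocycles R X q).subtype))

instance (q : ℕ) : Module R (Cohomology R X q) :=
  inferInstanceAs (Module R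
    (cocycles R X q ⧸ (coboundaries R X q).comap (cocycles R X q).subtype))

/-- The class of a cocycle. -/
def toClass (q : ℕ) : cocycles R X q →ₗ[R] Cohomology R X q :=
  ((coboundaries R X q).comap (cocycles R X q).subtype).mkQ

variable {R X}

theorem toClass_surjective (q : ℕ) : Function.Surjective (toClass R X q) :=
  Submodule.mkQ_surjective _

theorem mem_locallyZero_iff {q : ℕ} {f : Cochain R X q} :
    f ∈ locallyZero R X q ↔
      ∀ a : X, ∃ U ∈ 𝓝 a, ∀ y : ℕ → X, (∀ i, y i ∈ U) → f (res q y) = 0 := by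
  constructor
  · intro h a
    obtain ⟨U, hU, hU'⟩ := h a
    exact ⟨U, hU, fun y hy => hU' _ fun i => hy i⟩
  · intro h a
    obtain ⟨U, hU, hU'⟩ := h a
    refine ⟨U, hU, fun x hx => ?_⟩
    obtain ⟨y, rfl, hy⟩ := exists_res x
    refine hU' y fun i => ?_
    obtain ⟨j, hj⟩ := hy i
    exact hj ▸ hx j

theorem locallyZero_le_coboundaries (q : ℕ) : locallyZero R X q ≤ coboundaries R X q := by
  cases q with
  | zero => exact le_rfl
  | succ q => exact le_sup_left

theorem mem_coboundaries_of {n m : ℕ} (h : n = m + 1) (f : Cochain R X n) (k : Cochain R X m)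
    (hf : ∀ a : X, ∃ U ∈ 𝓝 a, ∀ y : ℕ → X, (∀ i, y i ∈ U) →
      f (res n y) = d R X m k (res (m + 1) y)) :
    f ∈ coboundaries R X n := by
  subst h
  have h1 : f - d R X m k ∈ locallyZero R X (m + 1) := by
    rw [mem_locallyZero_iff]
    intro a
    obtain ⟨U, hU, hU'⟩ := hf a
    exact ⟨U, hU, fun y hy => by simp [hU' y hy]⟩
  have h2 : f = (f - d R X m k) + d R X m k := by simp
  rw [h2]
  exact Submodule.add_mem_sup h1 ⟨k, rfl⟩

theorem cup_mem_cocycles {p q : ℕ} {f : Cochain R X p} {g : Cochain R X q}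
    (hf : f ∈ cocycles R X p) (hg : g ∈ cocycles R X q) :
    cupCochain f g ∈ cocycles R X (p + q) := by
  change d R X _ _ ∈ locallyZero R X _
  rw [mem_locallyZero_iff]
  intro a
  obtain ⟨U, hU, hU'⟩ := mem_locallyZero_iff.1 hf a
  obtain ⟨V, hV, hV'⟩ := mem_locallyZero_iff.1 hg a
  refine ⟨U ∩ V, Filter.inter_mem hU hV, fun y hy => ?_⟩
  rw [d_cup_res, hU' y fun i => (hy i).1, hV' _ fun i => (hy _).2]
  simp

theorem cup_mem_locallyZero_left {p q : ℕ} {f : Cochain R X p} (g : Cochain R X q)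
    (hf : f ∈ locallyZero R X p) : cupCochain f g ∈ locallyZero R X (p + q) := by
  rw [mem_locallyZero_iff] at hf ⊢
  intro a
  obtain ⟨U, hU, hU'⟩ := hf a
  exact ⟨U, hU, fun y hy => by rw [cup_res, hU' y hy, zero_mul]⟩

theorem cup_mem_locallyZero_right {p q : ℕ} (f : Cochain R X p) {g : Cochain R X q}
    (hg : g ∈ locallyZero R X q) : cupCochain f g ∈ locallyZero R X (p + q) := by
  rw [mem_locallyZero_iff] at hg ⊢
  intro a
  obtain ⟨U, hU, hU'⟩ := hg a
  exact ⟨U, hU, fun y hy => by rw [cup_res, hU' _ fun i => hy _, mul_zero]⟩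

theorem cup_mem_coboundaries_left {p q : ℕ} {f : Cochain R X p} {g : Cochain R X q}
    (hf : f ∈ coboundaries R X p) (hg : g ∈ cocycles R X q) :
    cupCochain f g ∈ coboundaries R X (p + q) := by
  cases p with
  | zero => exact locallyZero_le_coboundaries _ (cup_mem_locallyZero_left g hf)
  | succ p =>
    obtain ⟨c, hc, _, ⟨k, rfl⟩, rfl⟩ := Submodule.mem_sup.1 hf
    refine mem_coboundaries_of (m := p + q) (by omega) _ (cupCochain k g) fun a => ?_
    obtain ⟨U, hU, hU'⟩ := mem_locallyZero_iff.1 hc a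
    obtain ⟨V, hV, hV'⟩ := mem_locallyZero_iff.1 hg a
    refine ⟨U ∩ V, Filter.inter_mem hU hV, fun y hy => ?_⟩
    rw [cup_res, d_cup_res, Pi.add_apply, hU' y fun i => (hy i).1, hV' _ fun i => (hy _).2]
    simp

theorem cup_mem_coboundaries_right {p q : ℕ} {f : Cochain R X p} {g : Cochain R X q}
    (hf : f ∈ cocycles R X p) (hg : g ∈ coboundaries R X q) :
    cupCochain f g ∈ coboundaries R X (p + q) := by
  cases q with
  | zero => exact locallyZero_le_coboundaries _ (cup_mem_locallyZero_right f hg)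
  | succ q =>
    obtain ⟨c, hc, _, ⟨k, rfl⟩, rfl⟩ := Submodule.mem_sup.1 hg
    refine mem_coboundaries_of (m := p + q) (by omega) _ ((-1 : R) ^ p • cupCochain f k)
      fun a => ?_
    obtain ⟨U, hU, hU'⟩ := mem_locallyZero_iff.1 hc a
    obtain ⟨V, hV, hV'⟩ := mem_locallyZero_iff.1 hf a
    refine ⟨U ∩ V, Filter.inter_mem hU hV, fun y hy => ?_⟩
    rw [cup_res, map_smul, Pi.smul_apply, d_cup_res, Pi.add_apply, hU' _ fun i => (hy _).1,
      hV' y fun i => (hy i).2]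
    have : (-1 : R) ^ p * (-1) ^ p = 1 := by rw [← mul_pow]; simp
    simp [← mul_assoc, this]

/-- The cup product of cocycles, as a bilinear map into cohomology. -/
def cupCocycle (p q : ℕ) :
    cocycles R X p →ₗ[R] cocycles R X q →ₗ[R] Cohomology R X (p + q) :=
  LinearMap.mk₂ R
    (fun f g => toClass R X (p + q) ⟨cupCochain f.1 g.1, cup_mem_cocycles f.2 g.2⟩)
    (fun f f' g => by
      rw [← map_add]
      congr 1
      ext x
      simp [cupCochain, add_mul])
    (fun c f g => by
      rw [← map_smul]
      congr 1
      ext x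
      simp [cupCochain, mul_assoc])
    (fun f g g' => by
      rw [← map_add]
      congr 1
      ext x
      simp [cupCochain, mul_add])
    (fun c f g => by
      rw [← map_smul]
      congr 1
      ext x
      simp [cupCochain, mul_left_comm])

theorem toClass_eq_zero_iff {q : ℕ} (f : cocycles R X q) :
    toClass R X q f = 0 ↔ f.1 ∈ coboundaries R X q :=
  (Submodule.Quotient.mk_eq_zero _).trans Iff.rfl

/-- The cup product `H^p(X; R) × H^q(X; R) → H^{p+q}(X; R)`. -/
def cup (p q : ℕ) : Cohomology R X p →ₗ[R] Cohomology R X q →ₗ[R] Cohomology R X (p + q) :=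
  (Submodule.liftQ _
    (Submodule.liftQ _ (cupCocycle (R := R) (X := X) p q) (by
      intro f hf
      rw [LinearMap.mem_ker]
      refine LinearMap.ext fun g => ?_
      exact (toClass_eq_zero_iff _).2 (cup_mem_coboundaries_left hf g.2))).flip (by
      intro g hg
      rw [LinearMap.mem_ker]
      refine LinearMap.ext fun f => ?_
      obtain ⟨f, rfl⟩ := toClass_surjective p f
      exact (toClass_eq_zero_iff _).2 (cup_mem_coboundaries_right f.2 hg))).flip

theorem cup_toClass {p q : ℕ} (f : cocycles R X p) (g : cocycles R X q) :
    cup p q (toClass R X p f) (toClass R X q g) =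
      toClass R X (p + q) ⟨cupCochain f.1 g.1, cup_mem_cocycles f.2 g.2⟩ := rfl

variable (R X) in
/-- The constant `0`-cochain with value `1`. -/
def oneCocycle : cocycles R X 0 :=
  ⟨fun _ => 1, by
    change d R X 0 _ ∈ locallyZero R X 1
    have : d R X 0 (fun _ => 1) = 0 := by
      funext x
      simp [d, Fin.sum_univ_two]
    rw [this]
    exact Submodule.zero_mem _⟩

theorem mk_toClass_eq {m n : ℕ} (h : m = n) (f : cocycles R X m) (g : cocycles R X n)
    (hfg : ∀ y : ℕ → X, f.1 (res m y) = g.1 (res n y)) :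
    (GradedMonoid.mk m (toClass R X m f) : GradedMonoid (Cohomology R X)) =
      GradedMonoid.mk n (toClass R X n g) := by
  subst h
  congr 2
  ext x
  obtain ⟨y, rfl, -⟩ := exists_res x
  exact hfg y

instance : GradedMonoid.GOne (Cohomology R X) := ⟨toClass R X 0 (oneCocycle R X)⟩

instance : GradedMonoid.GMul (Cohomology R X) := ⟨fun {p q} a b => cup p q a b⟩

/-- The cup product makes Alexander–Spanier cohomology a graded ring. -/
instance : DirectSum.GRing (Cohomology R X) where
  mul_zero a := map_zero _
  zero_mul b := by
    change cup _ _ 0 b = 0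
    simp
  mul_add a b c := map_add _ _ _
  add_mul a b c := by
    change cup _ _ (a + b) c = cup _ _ a c + cup _ _ b c
    simp
  one_mul := by
    rintro ⟨p, a⟩
    obtain ⟨f, rfl⟩ := toClass_surjective p a
    refine mk_toClass_eq (Nat.zero_add p) _ f fun y => ?_
    simp [cup_res, oneCocycle]
  mul_one := by
    rintro ⟨p, a⟩
    obtain ⟨f, rfl⟩ := toClass_surjective p a
    refine mk_toClass_eq (Nat.add_zero p) _ f fun y => ?_
    change cupCochain _ _ (res (p + 0) y) = _
    rw [cup_res]
    simp [oneCocycle]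
  mul_assoc := by
    rintro ⟨p, a⟩ ⟨q, b⟩ ⟨r, c⟩
    obtain ⟨f, rfl⟩ := toClass_surjective p a
    obtain ⟨g, rfl⟩ := toClass_surjective q b
    obtain ⟨h, rfl⟩ := toClass_surjective r c
    refine mk_toClass_eq (Nat.add_assoc p q r)
      ⟨cupCochain (cupCochain f.1 g.1) h.1, cup_mem_cocycles (cup_mem_cocycles f.2 g.2) h.2⟩
      ⟨cupCochain f.1 (cupCochain g.1 h.1), cup_mem_cocycles f.2 (cup_mem_cocycles g.2 h.2)⟩
      fun y => ?_
    simp only [cup_res, mul_assoc, add_assoc]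
  natCast n := n • toClass R X 0 (oneCocycle R X)
  natCast_zero := zero_smul _ _
  natCast_succ n := succ_nsmul _ _
  intCast n := n • toClass R X 0 (oneCocycle R X)
  intCast_ofNat n := natCast_zsmul _ _
  intCast_negSucc_ofNat n := negSucc_zsmul _ _

variable (R X) in
/-- The Alexander–Spanier cohomology ring `H^*(X; R) = ⨁_q H^q(X; R)`, with cup product. -/
abbrev CohomologyRing : Type (max u w) := DirectSum ℕ (Cohomology R X)

end Cohomology

section PullCochain

variable (R : Type w) [CommRing R] {X : Type u} {Y : Type v}

/-- The pullback of cochains, `(φ^# f)(x₀, …, x_q) = f(φ x₀, …, φ x_q)`. -/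
def pullCochain (φ : X → Y) (q : ℕ) : Cochain R Y q →ₗ[R] Cochain R X q where
  toFun f x := f (fun i => φ (x i))
  map_add' _ _ := rfl
  map_smul' _ _ := rfl

theorem pullCochain_d (φ : X → Y) (q : ℕ) (f : Cochain R Y q) :
    pullCochain R φ (q + 1) (d R Y q f) = d R X q (pullCochain R φ q f) := rfl

end PullCochain

section Functoriality

variable {R : Type w} [CommRing R] {X : Type u} [TopologicalSpace X]
  {Y : Type v} [TopologicalSpace Y]

theorem pullCochain_mem_locallyZero (φ : C(X, Y)) {q : ℕ} {f : Cochain R Y q}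
    (hf : f ∈ locallyZero R Y q) : pullCochain R φ q f ∈ locallyZero R X q := by
  intro a
  obtain ⟨U, hU, hU'⟩ := hf (φ a)
  exact ⟨φ ⁻¹' U, φ.continuous.continuousAt hU, fun x hx => hU' _ hx⟩

theorem pullCochain_mem_cocycles (φ : C(X, Y)) {q : ℕ} {f : Cochain R Y q}
    (hf : f ∈ cocycles R Y q) : pullCochain R φ q f ∈ cocycles R X q :=
  pullCochain_mem_locallyZero φ hf

theorem pullCochain_mem_coboundaries (φ : C(X, Y)) {q : ℕ} {f : Cochain R Y q}
    (hf : f ∈ coboundaries R Y q) : pullCochain R φ q f ∈ coboundaries R X q := by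
  cases q with
  | zero => exact pullCochain_mem_locallyZero φ hf
  | succ q =>
    obtain ⟨c, hc, _, ⟨k, rfl⟩, rfl⟩ := Submodule.mem_sup.1 hf
    rw [map_add, pullCochain_d]
    exact Submodule.add_mem_sup (pullCochain_mem_locallyZero φ hc) ⟨_, rfl⟩

variable (R) in
/-- The map `φ^* : H^q(Y; R) → H^q(X; R)` induced by a continuous map `φ : X → Y`. -/
def pullback (φ : C(X, Y)) (q : ℕ) : Cohomology R Y q →ₗ[R] Cohomology R X q :=
  Submodule.mapQ _ _
    ((pullCochain R φ q).restrict (p := cocycles R Y q) (q := cocycles R X q)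
      fun _ hf => pullCochain_mem_cocycles φ hf)
    fun _ hf => pullCochain_mem_coboundaries φ hf

variable (R) in
/-- The ring homomorphism `φ^* : H^*(Y; R) → H^*(X; R)`, in each degree the map `pullback`. -/
def pullbackRing (φ : C(X, Y)) : CohomologyRing R Y →+* CohomologyRing R X :=
  DirectSum.toSemiring
    (fun q => (DirectSum.of (Cohomology R X) q).comp (pullback R φ q).toAddMonoidHom)
    rfl
    (by
      intro p q a b
      obtain ⟨f, rfl⟩ := toClass_surjective p a
      obtain ⟨g, rfl⟩ := toClass_surjective q b
      exact (DirectSum.of_mul_of (A := Cohomology R X) (pullback R φ p (toClass R Y p f))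
        (pullback R φ q (toClass R Y q g))).symm)

/-- The cup-length of a subset `S` of the cohomology ring: the supremum of the lengths of the
non-zero products of homogeneous elements of `S` of positive degree. -/
noncomputable def cupLength (S : Set (CohomologyRing R X)) : ℕ∞ :=
  ⨆ (m : ℕ) (_ : ∃ (k : Fin m → ℕ) (a : ∀ i, Cohomology R X (k i)),
    (∀ i, 1 ≤ k i ∧ DirectSum.of (Cohomology R X) (k i) (a i) ∈ S) ∧
    (List.ofFn fun i => DirectSum.of (Cohomology R X) (k i) (a i)).prod ≠ 0), (m : ℕ∞)

end Functoriality

end AlexanderSpanier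

/-! ### Symmetric products -/

/-- Two `k`-tuples are identified when they differ by a permutation of the coordinates. -/
def symProdSetoid (k : ℕ) (X : Type u) : Setoid (Fin k → X) where
  r v v' := ∃ ρ : Equiv.Perm (Fin k), ∀ i, v' i = v (ρ i)
  iseqv :=
    { refl := fun _ => ⟨1, fun _ => rfl⟩
      symm := by
        rintro v v' ⟨ρ, h⟩
        exact ⟨ρ⁻¹, fun i => by simp [h]⟩
      trans := by
        rintro v v' v'' ⟨ρ, h⟩ ⟨τ, h'⟩
        exact ⟨ρ * τ, fun i => by simp [h, h']⟩ }

/-- The symmetric product `SP^k(X) = X^k / S_k`, with the quotient topology. -/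
abbrev SymProd (k : ℕ) (X : Type u) : Type u := Quotient (symProdSetoid k X)

/-- The diagonal `δ_k : X → SP^k(X)`, `x ↦ [x, …, x]`. -/
def symDiag (k : ℕ) (X : Type u) [TopologicalSpace X] : C(X, SymProd k X) where
  toFun x := Quotient.mk _ fun _ => x
  continuous_toFun := continuous_quotient_mk'.comp (continuous_pi fun _ => continuous_id)

/-! ### Fibrations, parametrized inputs and fiberwise paths -/

/-- `p` is a Hurewicz fibration: it has the homotopy lifting property for all spaces. -/
def IsHurewiczFibration {E : Type u} {B : Type v} [TopologicalSpace E] [TopologicalSpace B]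
    (p : C(E, B)) : Prop :=
  ∀ (A : Type (max u v)) [TopologicalSpace A] (f : C(A, E)) (H : C(A × I, B)),
    (∀ a, H (a, 0) = p (f a)) →
      ∃ K : C(A × I, E), (∀ a, K (a, 0) = f a) ∧ ∀ z, p (K z) = H z

/-- The fiber product `E^r_B`, a subspace of `E^r`. -/
abbrev FiberProd {E : Type u} {B : Type v} [TopologicalSpace E] [TopologicalSpace B]
    (r : ℕ) (p : C(E, B)) : Type u :=
  {e : Fin r → E // ∀ i j, p (e i) = p (e j)}

/-- The diagonal `Δ_r : E → E^r_B`. -/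
def fiberDiag {E : Type u} {B : Type v} [TopologicalSpace E] [TopologicalSpace B]
    (r : ℕ) (p : C(E, B)) : C(E, FiberProd r p) where
  toFun e := ⟨fun _ => e, fun _ _ => rfl⟩
  continuous_toFun := by fun_prop

/-- The space `E^I_B` of paths in `E` that lie in a single fiber of `p`. -/
def FiberPath {E : Type u} {B : Type v} [TopologicalSpace E] [TopologicalSpace B]
    (p : C(E, B)) : Type u :=
  {γ : C(I, E) // ∃ b, ∀ t, p (γ t) = b}

section

variable {E : Type u} {B : Type v} [MetricSpace E] [TopologicalSpace B] (p : C(E, B))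

/-- The uniform metric on `E^I_B`, which induces the compact-open topology. -/
noncomputable instance : MetricSpace (FiberPath p) :=
  inferInstanceAs (MetricSpace {γ : C(I, E) // ∃ b, ∀ t, p (γ t) = b})

noncomputable instance : MeasurableSpace (FiberPath p) := borel _

instance : BorelSpace (FiberPath p) := ⟨rfl⟩

end

/-! ### Finitely supported probability measures and distributional complexity -/

/-- The points of positive mass of a probability measure; this is the support of a finitely
supported measure. -/
def massSupport {X : Type u} [MeasurableSpace X] (μ : ProbabilityMeasure X) : Set X :=
  {x | (μ : Measure X) {x} ≠ 0}

/-- The space `B_k(X)` of probability measures supported on at most `k` points of the metric space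
`X`, with the topology of the Lévy–Prokhorov metric. -/
abbrev FinProb (k : ℕ) (X : Type u) [MetricSpace X] [MeasurableSpace X] [BorelSpace X] : Type u :=
  {μ : LevyProkhorov (ProbabilityMeasure X) //
    ∃ F : Finset X, F.card ≤ k ∧ (μ.toMeasure : Measure X) (F : Set X)ᶜ = 0}

/-- The time `i / (r - 1)` (with `i` starting from `0`) in the unit interval. -/
noncomputable def stopTime (r : ℕ) (i : Fin r) : I :=
  ⟨(i : ℝ) / ((r : ℝ) - 1), by
    have h : ((i : ℕ) : ℝ) + 1 ≤ r := by exact_mod_cast i.2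
    have h0 : (0 : ℝ) ≤ (i : ℕ) := Nat.cast_nonneg _
    exact ⟨div_nonneg h0 (by linarith), div_le_one_of_le₀ (by linarith) (by linarith)⟩⟩

section

variable {E : Type u} {B : Type v} [MetricSpace E] [TopologicalSpace B]

/-- The paths `γ ∈ E^I_B` with `γ(i / (r - 1)) = e_i` for all `i`. -/
def pathsThrough (r : ℕ) (p : C(E, B)) (e : FiberProd r p) : Set (FiberPath p) :=
  {γ | ∀ i : Fin r, γ.1 (stopTime r i) = e.1 i}

/-- `s` is an `r`-th sequential parametrized `k`-distributed navigation algorithm for `p`: a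
continuous map `E^r_B → B_k(E^I_B)` such that each `s(e)` is supported on paths through `e`. -/
def IsNavigationAlgorithm (r k : ℕ) (p : C(E, B)) (s : C(FiberProd r p, FinProb k (FiberPath p))) :
    Prop :=
  ∀ e, massSupport (s e).1.toMeasure ⊆ pathsThrough r p e

/-- The `r`-th sequential parametrized distributional complexity `dTC_r[p : E → B]`: the smallest
`m` such that `p` admits an `r`-th sequential parametrized `(m + 1)`-distributed navigation
algorithm, and `⊤` if there is none. -/
noncomputable def dTC (r : ℕ) (p : C(E, B)) : ℕ∞ :=
  ⨅ (m : ℕ) (_ : ∃ s, IsNavigationAlgorithm r (m + 1) p s), (m : ℕ∞)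

end

/-! Suppose a navigation algorithm `s` uses at most `m + 1 ≤ n` atoms. Stratify `E^r_B` by the exact
number `k ∈ {1, …, n}` of atoms of `s(x)`. On one stratum the support is lower semicontinuous of
constant cardinality, so it moves continuously up to permutation. Since `k` divides `n!`, repeating
every atom `n!/k` times gives an unordered `n!`-tuple of paths through `x`. Shrinking these paths to
their common starting point is a homotopy, over the stratum, from `δ ∘ Δ_r ∘ (first coordinate)` to
`δ`. Hence a class `δ^* α^*` killed by `Δ_r^*` restricts to zero on each stratum.

The strata need be neither open nor closed, but `E^r_B` is metric and every subset of a metric space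
is taut for Alexander–Spanier cohomology: `α_i` has a representative that is locally zero around the
points of the `i`-th stratum. The cochain product of these `n` representatives is locally zero
everywhere, so `α_1 ⋯ α_n = 0`.

Homotopy invariance (`pullback_eq_of_homotopic`) and tautness (`exists_sub_d_eq_zero_near`) both
come from one prism operator, defined for arbitrary functions. -/

namespace AlexanderSpanier

/-! ### The prism operator as a cochain homotopy -/

section Prism

variable {R : Type w} [CommRing R] {X : Type u} {Y : Type v}

/-- The prism operator of two functions `g, h : X → Y`,
`(P f)(x₁, …, xₙ) = ∑ᵢ (-1)^{i-1} f(g x₁, …, g xᵢ, h xᵢ, …, h xₙ)`, by recursion on `n`. -/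
def prism (g h : X → Y) : (n : ℕ) → ((Fin (n + 1) → Y) → R) → (Fin n → X) → R
  | 0, _, _ => 0
  | n + 1, f, x =>
    f (Fin.cons (g (x 0)) (Fin.cons (h (x 0)) fun i => h (Fin.tail x i))) -
      prism g h n (fun y => f (Fin.cons (g (x 0)) y)) (Fin.tail x)

theorem prism_succ (g h : X → Y) (n : ℕ) (f : (Fin (n + 2) → Y) → R) (x : Fin (n + 1) → X) :
    prism g h (n + 1) f x =
      f (Fin.cons (g (x 0)) (Fin.cons (h (x 0)) fun i => h (Fin.tail x i))) -
        prism g h n (fun y => f (Fin.cons (g (x 0)) y)) (Fin.tail x) := rfl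

/-- The coboundary on functions of `n` variables, including `n = 0`. -/
def augD (n : ℕ) (f : (Fin n → X) → R) (x : Fin (n + 1) → X) : R :=
  ∑ i : Fin (n + 1), (-1 : R) ^ (i : ℕ) * f (fun j => x (i.succAbove j))

theorem augD_zero (f : (Fin 0 → X) → R) (x : Fin 1 → X) : augD 0 f x = f Fin.elim0 := by
  rw [augD, Fin.sum_univ_succ]
  simp only [Fin.val_zero, pow_zero, one_mul, Finset.univ_eq_empty, Finset.sum_empty, add_zero]
  congr 1
  exact Subsingleton.elim _ _

theorem augD_succ (n : ℕ) (f : (Fin (n + 1) → X) → R) (x : Fin (n + 2) → X) :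
    augD (n + 1) f x =
      f (Fin.tail x) - augD n (fun y => f (Fin.cons (x 0) y)) (Fin.tail x) := by
  rw [augD, Fin.sum_univ_succ, augD, sub_eq_add_neg, ← Finset.sum_neg_distrib]
  congr 1
  · simp [Fin.tail_def]
  · refine Finset.sum_congr rfl fun i _ => ?_
    have : (fun j => x (i.succ.succAbove j)) =
        Fin.cons (x 0) fun j => Fin.tail x (i.succAbove j) := by
      funext j
      refine Fin.cases ?_ (fun j => ?_) j
      · simp
      · simp [Fin.tail_def]
    rw [this, Fin.val_succ, pow_succ]
    ring

theorem prism_sub (g h : X → Y) (n : ℕ) (f f' : (Fin (n + 1) → Y) → R) (x : Fin n → X) :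
    prism g h n (fun y => f y - f' y) x = prism g h n f x - prism g h n f' x := by
  induction n with
  | zero => simp [prism]
  | succ n ih =>
    simp only [prism, ih]
    ring

theorem augD_sub (n : ℕ) (f f' : (Fin n → X) → R) (x : Fin (n + 1) → X) :
    augD n (fun y => f y - f' y) x = augD n f x - augD n f' x := by
  simp [augD, mul_sub]

theorem augD_augD (n : ℕ) (f : (Fin n → X) → R) (x : Fin (n + 2) → X) :
    augD (n + 1) (augD n f) x = 0 := by
  induction n with
  | zero =>
    rw [augD_succ, augD_zero, augD_zero, augD_zero, sub_self]
  | succ n ih =>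
    have h : (fun y => augD (n + 1) f (Fin.cons (x 0) y)) =
        fun y => f y - augD n (fun y => f (Fin.cons (x 0) y)) y := by
      funext y
      rw [augD_succ]
      simp
    rw [augD_succ, h, augD_sub, ih, sub_zero, sub_self]

/-- Both operators obey the same kind of recursion: a term for the first variable, minus the
operator applied to `f` with that variable frozen. Induction then works by freezing; starting from
no variables is what makes the base case trivial. -/
theorem augD_prism (g h : X → Y) (n : ℕ) (f : (Fin (n + 1) → Y) → R) (x : Fin (n + 1) → X) :
    augD n (prism g h n f) x + prism g h (n + 1) (augD (n + 1) f) x =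
      f (fun i => h (x i)) - f (fun i => g (x i)) := by
  induction n with
  | zero =>
    have e (k : X → Y) : (fun i => k (x i)) = Fin.cons (k (x 0)) (Fin.elim0 : Fin 0 → Y) := by
      funext i
      obtain rfl : i = 0 := Fin.fin_one_eq_zero i
      rfl
    have e' (y : Fin 0 → Y) : y = Fin.elim0 := Subsingleton.elim _ _
    rw [augD_zero, e h, e g]
    simp only [prism, augD_succ, augD_zero, e', Fin.tail_cons, Fin.cons_zero]
    ring
  | succ n ih =>
    obtain ⟨x₀, x, rfl⟩ : ∃ x₀ x', x = Fin.cons x₀ x' := ⟨_, _, (Fin.cons_self_tail x).symm⟩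
    have e (k : X → Y) : (fun i => k ((Fin.cons x₀ x : Fin (n + 2) → X) i)) =
        Fin.cons (k x₀) fun i => k (x i) := by
      funext i
      refine Fin.cases ?_ (fun i => ?_) i <;> simp
    have ih := ih (fun y => f (Fin.cons (g x₀) y)) x
    have h1 : (fun y => augD (n + 2) f (Fin.cons (g x₀) y)) =
        fun y => f y - augD (n + 1) (fun y => f (Fin.cons (g x₀) y)) y := by
      funext y
      rw [augD_succ]
      simp
    have h2 : (fun y => prism g h (n + 1) f (Fin.cons x₀ y)) = fun y =>
        f (Fin.cons (g x₀) (Fin.cons (h x₀) fun i => h (y i))) -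
          prism g h n (fun y => f (Fin.cons (g x₀) y)) y := by
      funext y
      rw [prism_succ]
      simp
    have h3 : augD n (fun y => f (Fin.cons (g x₀) (Fin.cons (h x₀) y))) (fun i => h (x i)) =
      augD n (fun y => f (Fin.cons (g x₀) (Fin.cons (h x₀) fun i => h (y i)))) x := rfl
    rw [e h, e g, augD_succ, prism_succ g h (n + 1)]
    simp only [Fin.tail_cons, Fin.cons_zero]
    rw [h1, h2, augD_sub, prism_sub, augD_succ (n + 1), augD_succ n]
    simp only [Fin.tail_cons, Fin.cons_zero]
    linear_combination ih + h3

theorem prism_eq_zero {g h : X → Y} {V : Set Y} {n : ℕ} {f : (Fin (n + 1) → Y) → R}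
    (hf : ∀ y : Fin (n + 1) → Y, (∀ i, y i ∈ V) → f y = 0) {x : Fin n → X}
    (hg : ∀ i, g (x i) ∈ V) (hh : ∀ i, h (x i) ∈ V) : prism g h n f x = 0 := by
  induction n with
  | zero => rfl
  | succ n ih =>
    rw [prism, hf, ih, sub_zero]
    · intro y hy
      refine hf _ fun i => ?_
      refine Fin.cases ?_ (fun i => ?_) i
      · exact hg 0
      · exact hy i
    · exact fun i => hg i.succ
    · exact fun i => hh i.succ
    · intro i
      refine Fin.cases ?_ (fun i => ?_) i
      · exact hg 0
      refine Fin.cases ?_ (fun i => ?_) i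
      · exact hh 0
      · exact hh i.succ

theorem prism_congr {g g' h h' : X → Y} {n : ℕ} (f : (Fin (n + 1) → Y) → R) {x : Fin n → X}
    (hg : ∀ i, g (x i) = g' (x i)) (hh : ∀ i, h (x i) = h' (x i)) :
    prism g h n f x = prism g' h' n f x := by
  induction n with
  | zero => rfl
  | succ n ih =>
    simp only [prism]
    have e : (fun i => h (Fin.tail x i)) = fun i => h' (Fin.tail x i) :=
      funext fun i => hh i.succ
    rw [hg 0, hh 0, e, ih (x := Fin.tail x) _ (fun i => hg i.succ) (fun i => hh i.succ)]

theorem d_prism (g h : X → Y) {q : ℕ} (f : Cochain R Y (q + 1)) (x : Fin (q + 2) → X) :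
    d R X q (prism g h (q + 1) f) x + prism g h (q + 2) (d R Y (q + 1) f) x =
      f (fun i => h (x i)) - f (fun i => g (x i)) :=
  augD_prism g h (q + 1) f x

theorem d_d {q : ℕ} (f : Cochain R X q) : d R X (q + 1) (d R X q f) = 0 :=
  funext fun x => augD_augD (q + 1) f x

theorem d_congr {q : ℕ} {f f' : Cochain R X q} {U : Set X}
    (h : ∀ x : Fin (q + 1) → X, (∀ i, x i ∈ U) → f x = f' x) {x : Fin (q + 2) → X}
    (hx : ∀ i, x i ∈ U) : d R X q f x = d R X q f' x := by
  change ∑ i : Fin (q + 2), _ = ∑ i : Fin (q + 2), _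
  exact Finset.sum_congr rfl fun (i : Fin (q + 2)) _ =>
    congrArg ((-1 : R) ^ (i : ℕ) * ·) (h _ fun j => hx (i.succAbove j))

end Prism

/-! ### Homotopy invariance at the cochain level -/

section Homotopy

variable {R : Type w} [CommRing R] {A : Type u} [MetricSpace A] {Y : Type v} [TopologicalSpace Y]

/-- Along a homotopy there is a step size, depending continuously on the point, such that times
that are one step apart have images in a common member of a given open cover. -/
theorem exists_continuous_step (H : C(A × I, Y)) (S : Set Y → Prop)
    (hS : ∀ y, ∃ V, IsOpen V ∧ S V ∧ y ∈ V) :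
    ∃ ε : C(A, ℝ), ∀ a, 0 < ε a ∧ ∀ t u : I, dist t u ≤ ε a →
      ∃ V, IsOpen V ∧ S V ∧ H (a, t) ∈ V ∧ H (a, u) ∈ V := by
  let T : A → Set ℝ := fun a => {e | 0 < e ∧ ∀ t u : I, dist t u ≤ e →
      ∃ V, IsOpen V ∧ S V ∧ H (a, t) ∈ V ∧ H (a, u) ∈ V}
  -- The admissible steps at `a` form an interval, so locally constant choices glue by a partition
  -- of unity on the metric space `A`.
  refine exists_continuous_forall_mem_convex_of_local_const (t := T) (fun a => ?_) fun a => ?_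
  · refine Set.OrdConnected.convex ⟨fun e he e' he' x hx => ⟨he.1.trans_le hx.1, ?_⟩⟩
    exact fun t u h => he'.2 t u (h.trans hx.2)
  · have hK : IsCompact (({a} : Set A) ×ˢ (Set.univ : Set I)) :=
      isCompact_singleton.prod isCompact_univ
    -- A Lebesgue number of the compact slice `{a} × I` also controls the slices over nearby `b`;
    -- halving it turns `≤` into `<`.
    obtain ⟨δ, hδ, hδ'⟩ := lebesgue_number_lemma_of_metric
      (c := fun V : {V : Set Y // IsOpen V ∧ S V} => H ⁻¹' V.1) hK
      (fun V => V.2.1.preimage H.continuous) (fun z _ => by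
        obtain ⟨V, h1, h2, h3⟩ := hS (H z)
        exact Set.mem_iUnion.2 ⟨⟨V, h1, h2⟩, h3⟩)
    refine ⟨δ / 2, ?_⟩
    filter_upwards [Metric.ball_mem_nhds a hδ] with b hb
    refine ⟨by positivity, fun t u htu => ?_⟩
    obtain ⟨V, hV⟩ := hδ' (a, t) ⟨rfl, trivial⟩
    refine ⟨V.1, V.2.1, V.2.2, hV ?_, hV ?_⟩
    · rw [Metric.mem_ball, Prod.dist_eq, dist_self]
      exact max_lt hb hδ
    · rw [Metric.mem_ball, Prod.dist_eq, max_lt_iff]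
      refine ⟨hb, ?_⟩
      rw [dist_comm]
      change dist t u < δ
      linarith

/-- Cut the homotopy at the times `min (1, j ε(a))`. Locally, consecutive stages `h j`, `h (j + 1)`
land in a common set on which `d c` vanishes, so the prism between them bounds the difference of the
pullbacks of `c`, and the differences telescope. -/
theorem pullCochain_sub_mem_coboundaries_of_homotopy (H : C(A × I, Y)) {q : ℕ}
    {c : Cochain R Y (q + 1)} (hc : c ∈ cocycles R Y (q + 1)) :
    pullCochain R (fun a => H (a, 1)) (q + 1) c - pullCochain R (fun a => H (a, 0)) (q + 1) c ∈
      coboundaries R A (q + 1) := by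
  obtain ⟨ε, hε⟩ := exists_continuous_step H
    (fun V => ∀ y : Fin (q + 3) → Y, (∀ i, y i ∈ V) → d R Y (q + 1) c y = 0) (fun y => by
      obtain ⟨U, hU, hU'⟩ := hc y
      obtain ⟨V, hVU, hV, hy⟩ := mem_nhds_iff.1 hU
      exact ⟨V, hV, fun x hx => hU' x fun i => hVU (hx i), hy⟩)
  let τ : ℕ → A → I := fun j a => Set.projIcc (0 : ℝ) 1 zero_le_one (j * ε a)
  have hτ : ∀ j, Continuous (τ j) := fun j => by fun_prop
  have hτ0 : ∀ a, τ 0 a = 0 := fun a => by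
    simp only [τ, Nat.cast_zero, zero_mul]
    exact Set.projIcc_left (zero_le_one' ℝ)
  have hτ1 : ∀ (j : ℕ) a, 1 ≤ j * ε a → τ j a = 1 := fun j a h =>
    Set.projIcc_of_right_le (zero_le_one' ℝ) h
  have hτs : ∀ j a, dist (τ j a) (τ (j + 1) a) ≤ ε a := fun j a => by
    refine ((LipschitzWith.projIcc (zero_le_one' ℝ)).dist_le_mul _ _).trans ?_
    rw [Real.dist_eq, Nat.cast_add, Nat.cast_one, add_mul, one_mul, sub_add_cancel_left, abs_neg,
      abs_of_pos (hε a).1]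
    simp
  let h : ℕ → A → Y := fun j a => H (a, τ j a)
  have hh : ∀ j, Continuous (h j) := fun j =>
    H.continuous.comp (continuous_id.prodMk (hτ j))
  -- A prism between equal maps need not vanish. Subtracting the degenerate prism makes `Q j` zero
  -- once the homotopy has stopped, and costs nothing since the degenerate prism is locally a
  -- cocycle.
  let Q : ℕ → Cochain R A q := fun j =>
    prism (h j) (h (j + 1)) (q + 1) c - prism (h (j + 1)) (h (j + 1)) (q + 1) c
  refine mem_coboundaries_of rfl _ (fun x => ∑ᶠ j, Q j x) fun a => ?_
  obtain ⟨J, hJ⟩ := exists_nat_gt (1 / ε a)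
  rw [div_lt_iff₀ (hε a).1] at hJ
  choose V hVo hV hV0 hV1 using fun j => (hε a).2 (τ j a) (τ (j + 1) a) (hτs j a)
  -- Here all stages from `J` on are at time `1`, so only the `Q j` with `j < J` contribute to the
  -- sum.
  refine ⟨{b | 1 < J * ε b ∧ ∀ j ∈ Finset.range J, h j b ∈ V j ∧ h (j + 1) b ∈ V j}, ?_, ?_⟩
  · refine Filter.Eventually.and ?_ ?_
    · exact (continuous_const.mul ε.continuous).continuousAt.eventually (lt_mem_nhds hJ)
    · rw [Filter.eventually_all_finset]
      intro j _
      exact ((hh j).continuousAt.eventually ((hVo j).mem_nhds (hV0 j))).and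
        ((hh (j + 1)).continuousAt.eventually ((hVo j).mem_nhds (hV1 j)))
  intro y hy
  generalize hx' : res (q + 1) y = x
  have hx : ∀ i, x i ∈ {b | 1 < J * ε b ∧
      ∀ j ∈ Finset.range J, h j b ∈ V j ∧ h (j + 1) b ∈ V j} := fun i => hx' ▸ hy i
  clear hx' hy y
  have hstep : ∀ b j, 1 < J * ε b → J ≤ j → h j b = H (b, 1) := fun b j hb hj => by
    simp only [h]
    rw [hτ1]
    have : (J : ℝ) * ε b ≤ j * ε b :=
      mul_le_mul_of_nonneg_right (by exact_mod_cast hj) (hε b).1.le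
    linarith
  have hK : ∀ z : Fin (q + 1) → A, (∀ i, z i ∈ {b | 1 < J * ε b ∧
      ∀ j ∈ Finset.range J, h j b ∈ V j ∧ h (j + 1) b ∈ V j}) →
      ∑ᶠ j, Q j z = (∑ j ∈ Finset.range J, Q j) z := fun z hz => by
    rw [Finset.sum_apply]
    refine finsum_eq_sum_of_support_subset _ fun j hj => ?_
    rw [Finset.mem_coe, Finset.mem_range]
    by_contra hJj
    rw [not_lt] at hJj
    refine hj (sub_eq_zero.2 (prism_congr _ (fun i => ?_) fun _ => rfl))
    rw [hstep _ _ (hz i).1 hJj, hstep _ _ (hz i).1 (hJj.trans j.le_succ)]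
  rw [d_congr hK hx, map_sum, Finset.sum_apply]
  have hQ : ∀ j ∈ Finset.range J, d R A q (Q j) x =
      c (fun i => h (j + 1) (x i)) - c (fun i => h j (x i)) := fun j hj => by
    have h1 := d_prism (h j) (h (j + 1)) c x
    have h2 := d_prism (h (j + 1)) (h (j + 1)) c x
    rw [prism_eq_zero (hV j) (fun i => ((hx i).2 j hj).1) (fun i => ((hx i).2 j hj).2)] at h1
    rw [prism_eq_zero (hV j) (fun i => ((hx i).2 j hj).2) (fun i => ((hx i).2 j hj).2)] at h2
    rw [map_sub, Pi.sub_apply]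
    linear_combination h1 - h2
  rw [Finset.sum_congr rfl hQ, Finset.sum_range_sub fun j => c fun i => h j (x i)]
  have e0 : (fun i => h 0 (x i)) = fun i => H (x i, 0) := funext fun i => by simp only [h, hτ0]
  have e1 : (fun i => h J (x i)) = fun i => H (x i, 1) :=
    funext fun i => hstep _ _ (hx i).1 le_rfl
  rw [e0, e1]
  rfl

end Homotopy

/-! ### Tautness of arbitrary subsets of metric spaces -/

section Taut

variable {R : Type w} [CommRing R] {X : Type u} [MetricSpace X]

/-- Given a radius `r a > 0` for each point `a` of a subset `A`, there is a map to `A` that is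
near the identity around the points of `A`, on the scale of these radii. -/
theorem exists_near_retraction {A : Set X} (hA : A.Nonempty) (r : A → ℝ) (hr : ∀ a, 0 < r a) :
    ∃ f : X → A, ∀ a ∈ A, ∃ b : A, ∃ U ∈ 𝓝 a, ∀ x ∈ U,
      x ∈ Metric.ball b.1 (r b) ∧ (f x).1 ∈ Metric.ball b.1 (r b) := by
  classical
  have : Nonempty A := hA.to_subtype
  -- A 1-Lipschitz scale, positive on `A`; capping the radii at `1` keeps the supremum finite. `f x`
  -- will be a point of `A` within `ρ x / 4` of `x` when there is one, and arbitrary otherwise; no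
  -- continuity is needed.
  let ρ : X → ℝ := fun x => ⨆ a : A, (min (r a) 1 - dist x a.1)
  have hb : ∀ x : X, BddAbove (Set.range fun a : A => min (r a) 1 - dist x a.1) := fun x =>
    ⟨1, by
      rintro _ ⟨a, rfl⟩
      have : min (r a) 1 ≤ 1 := min_le_right _ _
      have := @dist_nonneg X _ x a.1
      dsimp only
      linarith⟩
  have hρ : ∀ a : A, 0 < ρ a := fun a => by
    refine lt_of_lt_of_le ?_ (le_ciSup (hb a) a)
    simpa using hr a
  have hlip : ∀ x y : X, ρ x ≤ ρ y + dist x y := fun x y => by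
    refine ciSup_le fun a => ?_
    have h1 := le_ciSup (hb y) a
    have h2 := dist_triangle_left y a.1 x
    change _ ≤ ρ y at h1
    linarith
  have hf : ∀ x : X, ∃ b : A, (∃ a : A, dist x a.1 < ρ x / 4) → dist x b.1 < ρ x / 4 := by
    intro x
    by_cases h : ∃ a : A, dist x a.1 < ρ x / 4
    · exact ⟨h.choose, fun _ => h.choose_spec⟩
    · exact ⟨Classical.arbitrary A, fun h' => absurd h' h⟩
  choose f hf using hf
  refine ⟨f, fun a ha => ?_⟩
  have ha0 := hρ ⟨a, ha⟩
  dsimp only at ha0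
  -- For `dist x a < ρ a / 8`, this leaves `x` a margin of `3/8 ρ a` inside the ball of `b`, while
  -- `f x` is within `9/32 ρ a` of `x`.
  obtain ⟨b, hb'⟩ := exists_lt_of_lt_ciSup (show ρ a / 2 < ρ a by linarith)
  have hmin : min (r b) 1 ≤ r b := min_le_left _ _
  refine ⟨b, Metric.ball a (ρ a / 8), Metric.ball_mem_nhds _ (by positivity), fun x hx => ?_⟩
  rw [Metric.mem_ball] at hx
  have h1 := hlip a x
  have h2 := hlip x a
  rw [dist_comm a x] at h1
  have h3 := hf x ⟨⟨a, ha⟩, by dsimp only; linarith⟩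
  have h4 := dist_triangle x a b.1
  have h5 := dist_triangle_left (f x).1 b.1 x
  rw [Metric.mem_ball, Metric.mem_ball]
  constructor <;> linarith

/-- Subsets of metric spaces are taut: a cocycle whose restriction to `A` is a coboundary becomes
locally zero around the points of `A` after subtraction of a coboundary. -/
theorem exists_sub_d_eq_zero_near {A : Set X} {q : ℕ} {c : Cochain R X (q + 1)}
    (hc : c ∈ cocycles R X (q + 1))
    (hA : pullCochain R (Subtype.val : A → X) (q + 1) c ∈ coboundaries R A (q + 1)) :
    ∃ k : Cochain R X q, ∀ a ∈ A, ∃ U ∈ 𝓝 a, ∀ x : Fin (q + 2) → X, (∀ i, x i ∈ U) →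
      (c - d R X q k) x = 0 := by
  rcases A.eq_empty_or_nonempty with rfl | hne
  · exact ⟨0, fun a ha => ha.elim⟩
  obtain ⟨z, hz, _, ⟨k, rfl⟩, hzk⟩ := Submodule.mem_sup.1 hA
  have hr : ∀ a : A, ∃ r > 0,
      (∀ x : Fin (q + 3) → X, (∀ i, x i ∈ Metric.ball a.1 r) → d R X (q + 1) c x = 0) ∧
      ∀ x : Fin (q + 2) → A, (∀ i, (x i).1 ∈ Metric.ball a.1 r) → z x = 0 := fun a => by
    obtain ⟨U, hU, hU'⟩ := hc a
    obtain ⟨V, hV, hV'⟩ := hz a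
    obtain ⟨r₁, h₁, hr₁⟩ := Metric.mem_nhds_iff.1 hU
    obtain ⟨r₂, h₂, hr₂⟩ := Metric.mem_nhds_iff.1 hV
    refine ⟨min r₁ r₂, lt_min h₁ h₂, fun x hx => hU' x fun i => hr₁ ?_,
      fun x hx => hV' x fun i => hr₂ ?_⟩
    · exact Metric.ball_subset_ball (min_le_left _ _) (hx i)
    · exact Metric.ball_subset_ball (min_le_right _ _) (hx i)
  choose r hr0 hr1 hr2 using hr
  obtain ⟨f, hf⟩ := exists_near_retraction hne r hr0
  -- Near `A` the prism from `id` to `f` makes `c` cohomologous to `f^#(c|_A) = f^# z + d (f^# k)`,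
  -- and `f^# z` vanishes there.
  refine ⟨pullCochain R f q k - prism id (fun x => (f x).1) (q + 1) c, fun a ha => ?_⟩
  obtain ⟨b, U, hU, hU'⟩ := hf a ha
  refine ⟨U, hU, fun x hx => ?_⟩
  have h1 := d_prism id (fun x => (f x).1) c x
  rw [prism_eq_zero (g := id) (hr1 b) (fun i => (hU' _ (hx i)).1) (fun i => (hU' _ (hx i)).2)] at h1
  have h2 := congrFun hzk fun i => f (x i)
  rw [Pi.add_apply, hr2 b _ fun i => (hU' _ (hx i)).2] at h2
  have h3 : d R X q (pullCochain R f q k) x = d R A q k fun i => f (x i) := rfl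
  have h4 : pullCochain R (Subtype.val : A → X) (q + 1) c (fun i => f (x i)) =
    c fun i => (f (x i)).1 := rfl
  rw [Pi.sub_apply, map_sub, Pi.sub_apply, h3]
  rw [h4] at h2
  simp only [id] at h1
  linear_combination h1 - h2

end Taut

/-! ### Products of classes that vanish near subsets -/

section VanishesNear

variable {R : Type w} [CommRing R] {X : Type u} [TopologicalSpace X]

/-- A homogeneous cohomology class that has a representative which is locally zero around every
point of `W`. -/
def VanishesNear (a : CohomologyRing R X) (W : Set X) : Prop :=
  ∃ (k : ℕ) (b : cocycles R X k), a = DirectSum.of (Cohomology R X) k (toClass R X k b) ∧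
    ∀ x ∈ W, ∃ U ∈ 𝓝 x, ∀ y : ℕ → X, (∀ i, y i ∈ U) → b.1 (res k y) = 0

/-- A tuple close to a point of `W` has its front face there, which kills the first factor; close to
`W'` the back face kills the second. -/
theorem VanishesNear.mul {a a' : CohomologyRing R X} {W W' : Set X} (h : VanishesNear a W)
    (h' : VanishesNear a' W') : VanishesNear (a * a') (W ∪ W') := by
  obtain ⟨k, b, rfl, hb⟩ := h
  obtain ⟨k', b', rfl, hb'⟩ := h'
  refine ⟨k + k', ⟨cupCochain b.1 b'.1, cup_mem_cocycles b.2 b'.2⟩, ?_, ?_⟩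
  · rw [DirectSum.of_mul_of]
    rfl
  · rintro x (hx | hx)
    · obtain ⟨U, hU, hU'⟩ := hb x hx
      exact ⟨U, hU, fun y hy => by
        change cupCochain b.1 b'.1 (res (k + k') y) = 0
        rw [cup_res, hU' y hy, zero_mul]⟩
    · obtain ⟨U, hU, hU'⟩ := hb' x hx
      exact ⟨U, hU, fun y hy => by
        change cupCochain b.1 b'.1 (res (k + k') y) = 0
        rw [cup_res, hU' _ fun i => hy _, mul_zero]⟩

theorem vanishesNear_one : VanishesNear (1 : CohomologyRing R X) ∅ :=
  ⟨0, oneCocycle R X, rfl, fun _ h => h.elim⟩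

theorem VanishesNear.eq_zero {a : CohomologyRing R X} (h : VanishesNear a Set.univ) : a = 0 := by
  obtain ⟨k, b, rfl, hb⟩ := h
  have : toClass R X k b = 0 := (toClass_eq_zero_iff b).2 <| locallyZero_le_coboundaries k <|
    mem_locallyZero_iff.2 fun x => hb x trivial
  rw [this, map_zero]

theorem VanishesNear.prod_ofFn {n : ℕ} {a : Fin n → CohomologyRing R X} {W : Fin n → Set X}
    (h : ∀ i, VanishesNear (a i) (W i)) : VanishesNear (List.ofFn a).prod (⋃ i, W i) := by
  induction n with
  | zero => simpa using vanishesNear_one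
  | succ n ih =>
    have e : ⋃ i, W i = W 0 ∪ ⋃ i : Fin n, W i.succ := by
      ext x
      simp [Fin.exists_fin_succ]
    rw [List.ofFn_succ, List.prod_cons, e]
    exact (h 0).mul (ih fun i => h i.succ)

end VanishesNear

/-! ### Homotopy invariance and tautness for cohomology classes -/

section Pullback

variable {R : Type w} [CommRing R] {X : Type u} [TopologicalSpace X]
  {Y : Type v} [TopologicalSpace Y]

theorem pullback_toClass (φ : C(X, Y)) (q : ℕ) (f : cocycles R Y q) :
    pullback R φ q (toClass R Y q f) =
      toClass R X q ⟨pullCochain R φ q f.1, pullCochain_mem_cocycles φ f.2⟩ := rfl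

theorem pullback_comp {Z : Type*} [TopologicalSpace Z] (φ : C(X, Y)) (ψ : C(Y, Z)) (q : ℕ)
    (a : Cohomology R Z q) :
    pullback R (ψ.comp φ) q a = pullback R φ q (pullback R ψ q a) := by
  obtain ⟨f, rfl⟩ := toClass_surjective q a
  rfl

theorem pullbackRing_of (φ : C(X, Y)) (q : ℕ) (a : Cohomology R Y q) :
    pullbackRing R φ (DirectSum.of (Cohomology R Y) q a) =
      DirectSum.of (Cohomology R X) q (pullback R φ q a) :=
  DirectSum.toSemiring_of _ _ _ _ _

theorem pullbackRing_apply (φ : C(X, Y)) (q : ℕ) (a : CohomologyRing R Y) :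
    pullbackRing R φ a q = pullback R φ q (a q) := by
  classical
  induction a using DirectSum.induction_on with
  | zero => simp
  | of k a =>
    rw [pullbackRing_of]
    by_cases h : k = q
    · subst h
      rw [DirectSum.of_eq_same, DirectSum.of_eq_same]
    · rw [DirectSum.of_eq_of_ne _ _ _ (Ne.symm h), DirectSum.of_eq_of_ne _ _ _ (Ne.symm h),
        map_zero]
  | add a b ha hb => rw [map_add, DirectSum.add_apply, DirectSum.add_apply, map_add, ha, hb]

/-- Homotopy invariance of Alexander–Spanier cohomology, in positive degrees and for homotopies
between maps that are defined on a metric space. -/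
theorem pullback_eq_of_homotopic {A : Type*} [MetricSpace A] {φ ψ : C(A, Y)}
    (h : φ.Homotopic ψ) {q : ℕ} (hq : 1 ≤ q) (a : Cohomology R Y q) :
    pullback R φ q a = pullback R ψ q a := by
  obtain ⟨q, rfl⟩ := Nat.exists_eq_add_of_le' hq
  obtain ⟨H⟩ := h
  obtain ⟨f, rfl⟩ := toClass_surjective _ a
  symm
  rw [pullback_toClass, pullback_toClass, ← sub_eq_zero, ← map_sub, toClass_eq_zero_iff]
  have := pullCochain_sub_mem_coboundaries_of_homotopy
    (H.toContinuousMap.comp ⟨Prod.swap, continuous_swap⟩) f.2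
  have e0 : (fun a => (H.toContinuousMap.comp ⟨Prod.swap, continuous_swap⟩) (a, 0)) = φ :=
    funext fun a => H.apply_zero a
  have e1 : (fun a => (H.toContinuousMap.comp ⟨Prod.swap, continuous_swap⟩) (a, 1)) = ψ :=
    funext fun a => H.apply_one a
  rwa [e0, e1] at this

theorem vanishesNear_of_pullback_eq_zero {X : Type*} [MetricSpace X] {A : Set X} {q : ℕ}
    (hq : 1 ≤ q) {a : Cohomology R X q}
    (ha : pullback R (⟨Subtype.val, continuous_subtype_val⟩ : C(A, X)) q a = 0) :
    VanishesNear (DirectSum.of (Cohomology R X) q a) A := by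
  obtain ⟨q, rfl⟩ := Nat.exists_eq_add_of_le' hq
  obtain ⟨f, rfl⟩ := toClass_surjective _ a
  rw [pullback_toClass, toClass_eq_zero_iff] at ha
  obtain ⟨k, hk⟩ := exists_sub_d_eq_zero_near f.2 ha
  have hd : d R X q k ∈ coboundaries R X (q + 1) := Submodule.mem_sup_right ⟨k, rfl⟩
  have hd' : d R X q k ∈ cocycles R X (q + 1) := by
    change d R X (q + 1) (d R X q k) ∈ locallyZero R X (q + 2)
    rw [d_d]
    exact Submodule.zero_mem _
  refine ⟨q + 1, f - ⟨d R X q k, hd'⟩, ?_, fun x hx => ?_⟩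
  · rw [map_sub, (toClass_eq_zero_iff ⟨d R X q k, hd'⟩).2 hd, sub_zero]
  · obtain ⟨U, hU, hU'⟩ := hk x hx
    exact ⟨U, hU, fun y hy => hU' _ fun i => hy i⟩

end Pullback

end AlexanderSpanier

/-! ### Lower semicontinuity of the support -/

section Support

theorem massSupport_subset {P : Type u} [MeasurableSpace P] {μ : ProbabilityMeasure P}
    {F : Set P} (hF : (μ : Measure P) Fᶜ = 0) :
    massSupport μ ⊆ F := fun x hx => by
  by_contra h
  exact hx (measure_mono_null (Set.singleton_subset_iff.2 h) hF)

theorem massSupport_inter_nonempty {P : Type u} [MeasurableSpace P] {μ : ProbabilityMeasure P}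
    {F : Finset P}
    (hF : (μ : Measure P) (F : Set P)ᶜ = 0) {V : Set P} (hV : (μ : Measure P) V ≠ 0) :
    (massSupport μ ∩ V).Nonempty := by
  by_contra h
  rw [Set.not_nonempty_iff_eq_empty] at h
  refine hV (measure_mono_null (t := (F : Set P)ᶜ ∪ ⋃ x ∈ (F : Set P) ∩ V, {x}) ?_ ?_)
  · intro x hx
    by_cases hxF : x ∈ (F : Set P)
    · exact Or.inr (Set.mem_iUnion₂.2 ⟨x, ⟨hxF, hx⟩, rfl⟩)
    · exact Or.inl hxF
  · refine measure_union_null hF ?_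
    rw [measure_biUnion_null_iff (F.countable_toSet.mono Set.inter_subset_left)]
    intro x hx
    by_contra hx0
    exact (h ▸ (⟨hx0, hx.2⟩ : x ∈ massSupport μ ∩ V) : x ∈ (∅ : Set P))

variable {P : Type u} [MetricSpace P] [MeasurableSpace P] [BorelSpace P]

theorem eventually_measure_ne_zero (μ₀ : LevyProkhorov (ProbabilityMeasure P)) {γ : P}
    (hγ : γ ∈ massSupport μ₀.toMeasure) {V : Set P} (hV : V ∈ 𝓝 γ) :
    ∀ᶠ μ in 𝓝 μ₀, (μ.toMeasure : Measure P) V ≠ 0 := by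
  obtain ⟨ε, hε, hεV⟩ := Metric.mem_nhds_iff.1 hV
  set m := (μ₀.toMeasure : Measure P) {γ} with hm
  have hm0 : m ≠ 0 := hγ
  have hmt : m ≠ ⊤ := measure_ne_top _ _
  -- At distance below `c`, `m ≤ μ (c-thickening of γ) + c ≤ μ V + m / 2`, so `μ V` cannot be zero.
  set c := min (ENNReal.ofReal ε) (m / 2) with hc
  have hc0 : 0 < c := lt_min (ENNReal.ofReal_pos.2 hε) (ENNReal.half_pos hm0)
  filter_upwards [Metric.eball_mem_nhds μ₀ hc0] with μ hμ h0
  rw [Metric.mem_eball, edist_comm, LevyProkhorov.edist_probabilityMeasure_def] at hμ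
  have h1 := left_measure_le_of_levyProkhorovEDist_lt hμ (measurableSet_singleton γ)
  have h2 : Metric.thickening c.toReal {γ} ⊆ V := by
    rw [Metric.thickening_singleton]
    refine (Metric.ball_subset_ball ?_).trans hεV
    exact ENNReal.toReal_le_of_le_ofReal hε.le (min_le_left _ _)
  rw [measure_mono_null h2 h0, zero_add] at h1
  exact (h1.trans (min_le_right _ _)).not_gt (ENNReal.half_lt_self hm0 hmt)

theorem massSupport_finProb {k : ℕ} (μ : FinProb k P) :
    (massSupport μ.1.toMeasure).Finite ∧ (massSupport μ.1.toMeasure).Nonempty ∧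
      (massSupport μ.1.toMeasure).ncard ≤ k := by
  obtain ⟨F, hFk, hF⟩ := μ.2
  have hs := massSupport_subset hF
  refine ⟨F.finite_toSet.subset hs, ?_, ?_⟩
  · refine (massSupport_inter_nonempty hF (V := Set.univ) ?_).mono Set.inter_subset_left
    simp
  · exact (Set.ncard_le_ncard hs F.finite_toSet).trans (by rwa [Set.ncard_coe_finset])

/-- The support of a finitely supported probability measure is lower semicontinuous. -/
theorem eventually_massSupport_inter_nonempty {k : ℕ} (μ₀ : FinProb k P) {γ : P}
    (hγ : γ ∈ massSupport μ₀.1.toMeasure) {V : Set P} (hV : V ∈ 𝓝 γ) :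
    ∀ᶠ μ : FinProb k P in 𝓝 μ₀, (massSupport μ.1.toMeasure ∩ V).Nonempty := by
  filter_upwards [continuous_subtype_val.continuousAt.eventually
    (eventually_measure_ne_zero μ₀.1 hγ hV)] with μ hμ
  obtain ⟨F, -, hF⟩ := μ.2
  exact massSupport_inter_nonempty hF hμ

end Support

/-! ### Continuity of unordered enumerations -/

section Enumeration

variable {A : Type*} [TopologicalSpace A] {P : Type*} [TopologicalSpace P]

/-- If a set-valued map is lower semicontinuous and all its values have `k` elements, then
enumerations of these values are continuous up to permutations. -/
theorem eventually_exists_perm [T2Space P] {k : ℕ} {S : A → Set P}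
    (hS : ∀ x, ∀ γ ∈ S x, ∀ V ∈ 𝓝 γ, ∀ᶠ y in 𝓝 x, (S y ∩ V).Nonempty)
    (e : ∀ x, Fin k ≃ S x) (x : A) (V : Fin k → Set P) (hV : ∀ j, V j ∈ 𝓝 (e x j).1) :
    ∀ᶠ y in 𝓝 x, ∃ τ : Equiv.Perm (Fin k), ∀ j, (e y (τ j)).1 ∈ V j := by
  obtain ⟨U, hU, hUd⟩ := (Set.finite_range fun j => (e x j).1).t2_separation
  have h : ∀ᶠ y in 𝓝 x, ∀ j, (S y ∩ (V j ∩ U (e x j).1)).Nonempty :=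
    Filter.eventually_all.2 fun j => hS x _ (e x j).2 _
      (Filter.inter_mem (hV j) ((hU _).2.mem_nhds (hU _).1))
  filter_upwards [h] with y hy
  choose γ hγS hγV hγU using hy
  -- The disjoint neighbourhoods contain distinct points of `S y`; as `S y` has only `k` elements,
  -- these exhaust it.
  have hinj : Function.Injective fun j => (e y).symm ⟨γ j, hγS j⟩ := fun i j hij => by
    have hij : γ i = γ j := congrArg Subtype.val ((e y).symm.injective hij)
    by_contra hne
    have hne' : (e x i).1 ≠ (e x j).1 := fun h => hne ((e x).injective (Subtype.ext h))
    exact Set.disjoint_left.1 (hUd ⟨i, rfl⟩ ⟨j, rfl⟩ hne') (hγU i) (hij ▸ hγU j)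
  refine ⟨Equiv.ofBijective _ (Finite.injective_iff_bijective.1 hinj), fun j => ?_⟩
  simpa using hγV j

/-- Enumerations that are continuous up to permutations give rise to continuous maps to symmetric
products, in which each value may be repeated. -/
theorem continuous_symProd_mk {Z : Type u} [TopologicalSpace Z] {T : Type*} [TopologicalSpace T]
    {k m N : ℕ} (ι : Fin N ≃ Fin k × Fin m) {e : A → Fin k → P}
    (he : ∀ x, ∀ V : Fin k → Set P, (∀ j, V j ∈ 𝓝 (e x j)) →
      ∀ᶠ y in 𝓝 x, ∃ τ : Equiv.Perm (Fin k), ∀ j, e y (τ j) ∈ V j)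
    {F : P × T → Z} (hF : Continuous F) :
    Continuous fun z : T × A =>
      (Quotient.mk _ fun l => F (e z.2 (ι l).1, z.1) : SymProd N Z) := by
  rw [continuous_iff_continuousAt]
  rintro ⟨t, x⟩ O hO
  have hO' := (continuous_quotient_mk' (s := symProdSetoid N Z)).continuousAt hO
  rw [nhds_pi, Filter.mem_map, Filter.mem_pi] at hO'
  obtain ⟨L, -, W, hW, hWO⟩ := hO'
  have hW' : ∀ l, ∃ V ∈ 𝓝 (e x (ι l).1), ∃ T' ∈ 𝓝 t, V ×ˢ T' ⊆ F ⁻¹' W l := fun l =>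
    mem_nhds_prod_iff.1 (hF.continuousAt (hW l))
  choose V hV T' hT' hVT using hW'
  -- All `m` copies of an entry are moved by the same `τ`, so their neighbourhoods are intersected.
  have hA := he x (fun j => ⋂ b, V (ι.symm (j, b))) fun j =>
    Filter.iInter_mem.2 fun b => by simpa using hV (ι.symm (j, b))
  have hT : ∀ᶠ u in 𝓝 t, ∀ l, u ∈ T' l := Filter.eventually_all.2 hT'
  rw [Filter.mem_map]
  filter_upwards [hT.prod_nhds hA]
  rintro ⟨u, y⟩ ⟨hu, τ, hτ⟩
  let ρ : Equiv.Perm (Fin N) := (ι.trans (τ.prodCongr (Equiv.refl _))).trans ι.symm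
  have hq : (Quotient.mk (symProdSetoid N Z) fun l => F (e y (ι l).1, u)) =
      Quotient.mk _ fun l => F (e y (τ (ι l).1), u) :=
    Quotient.sound ⟨ρ, fun l => by simp [ρ]⟩
  rw [Set.mem_preimage, hq]
  refine hWO fun l _ => hVT l ⟨?_, hu l⟩
  have := Set.mem_iInter.1 (hτ (ι l).1) (ι l).2
  simpa using this

end Enumeration

/-! ### Contracting the paths of a navigation algorithm -/

section Navigation

variable {E : Type u} {B : Type v} [MetricSpace E] [TopologicalSpace B]

/-- The values of a fiberwise path at the rescaled times `t · i / (r - 1)`. -/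
noncomputable def contractStops (r : ℕ) (p : C(E, B)) (z : FiberPath p × I) : FiberProd r p :=
  ⟨fun l => z.1.1 (z.2 * stopTime r l), fun i j => by
    obtain ⟨b, hb⟩ := z.1.2
    rw [hb, hb]⟩

theorem continuous_contractStops (r : ℕ) (p : C(E, B)) : Continuous (contractStops r p) := by
  refine Continuous.subtype_mk (continuous_pi fun l => ?_) _
  have h : Continuous fun z : FiberPath p × I => (z.1.1 : C(I, E)) :=
    (continuous_subtype_val (p := fun γ : C(I, E) => ∃ b, ∀ t, p (γ t) = b)).comp continuous_fst
  exact continuous_eval.comp (h.prodMk (continuous_snd.mul continuous_const))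

theorem contractStops_one {r : ℕ} {p : C(E, B)} {e : FiberProd r p} {γ : FiberPath p}
    (h : γ ∈ pathsThrough r p e) : contractStops r p (γ, 1) = e := by
  refine Subtype.ext (funext fun l => ?_)
  simpa [contractStops] using h l

/-- The first coordinate `E^r_B → E`. -/
def fiberProdFst {r : ℕ} (hr : 0 < r) (p : C(E, B)) : C(FiberProd r p, E) where
  toFun e := e.1 ⟨0, hr⟩
  continuous_toFun := (continuous_apply _).comp continuous_subtype_val

theorem contractStops_zero {r : ℕ} (hr : 0 < r) {p : C(E, B)} {e : FiberProd r p}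
    {γ : FiberPath p} (h : γ ∈ pathsThrough r p e) :
    contractStops r p (γ, 0) = fiberDiag r p (fiberProdFst hr p e) := by
  refine Subtype.ext (funext fun l => ?_)
  have h0 : stopTime r ⟨0, hr⟩ = 0 := Subtype.ext (by simp [stopTime])
  have := h ⟨0, hr⟩
  rw [h0] at this
  simpa [contractStops, fiberDiag, fiberProdFst] using this

/-- On the stratum where a navigation algorithm takes measures with exactly `k` atoms, the diagonal
map to the `N`-th symmetric product factors up to homotopy through `Δ_r` if `k` divides `N`. -/
theorem homotopic_symDiag_comp {r m : ℕ} (hr : 0 < r) {p : C(E, B)}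
    {s : C(FiberProd r p, FinProb m (FiberPath p))} (hs : IsNavigationAlgorithm r m p s)
    {k N : ℕ} (hk : k ∣ N) {A : Set (FiberProd r p)}
    (hA : ∀ x ∈ A, (massSupport (s x).1.toMeasure).ncard = k) :
    (((symDiag N (FiberProd r p)).comp ((fiberDiag r p).comp (fiberProdFst hr p))).comp
      (⟨Subtype.val, continuous_subtype_val⟩ : C(A, FiberProd r p))).Homotopic
    ((symDiag N (FiberProd r p)).comp
      (⟨Subtype.val, continuous_subtype_val⟩ : C(A, FiberProd r p))) := by
  obtain ⟨b, rfl⟩ := hk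
  let S : A → Set (FiberPath p) := fun x => massSupport (s x.1).1.toMeasure
  have hcard : ∀ x : A, Nonempty (Fin k ≃ S x) := fun x => by
    have hfin : Finite (S x) := (massSupport_finProb (s x.1)).1
    have hc : Nat.card (S x) = k := hA x x.2
    exact ⟨((finCongr hc).symm.trans (Finite.equivFin (S x)).symm)⟩
  let e : ∀ x : A, Fin k ≃ S x := fun x => (hcard x).some
  have hS : ∀ x, ∀ γ ∈ S x, ∀ V ∈ 𝓝 γ, ∀ᶠ y in 𝓝 x, (S y ∩ V).Nonempty := fun x γ hγ V hV =>
    (s.continuous.comp continuous_subtype_val).continuousAt.eventually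
      (eventually_massSupport_inter_nonempty (s x.1) hγ hV)
  have hpath : ∀ x j, (e x j).1 ∈ pathsThrough r p x.1 := fun x j => hs x.1 (e x j).2
  -- Every atom is listed `b` times and evaluated at the stops rescaled by `t`. The paths all start
  -- at the first entry of `x` and pass through `x`, so both ends of the homotopy lie on the
  -- diagonal of the symmetric product.
  refine ⟨⟨⟨_, continuous_symProd_mk finProdFinEquiv.symm (eventually_exists_perm hS e)
    (continuous_contractStops r p)⟩, fun x => ?_, fun x => ?_⟩⟩
  · refine congrArg (Quotient.mk (symProdSetoid (k * b) (FiberProd r p))) (funext fun l => ?_)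
    exact contractStops_zero hr (hpath x _)
  · refine congrArg (Quotient.mk (symProdSetoid (k * b) (FiberProd r p))) (funext fun l => ?_)
    exact contractStops_one (hpath x _)

end Navigation

/-! ### The cohomological lower bound -/

section LowerBound

open AlexanderSpanier

variable {E : Type u} {B : Type v} [MetricSpace E] [TopologicalSpace B]

theorem le_dTC_of_prod_ne_zero (p : C(E, B)) {r n : ℕ} (hr : 0 < r) (R : Type w) [CommRing R]
    (k : Fin n → ℕ) (αstar : ∀ i, Cohomology R (SymProd n.factorial (FiberProd r p)) (k i))
    (α : ∀ i, Cohomology R (FiberProd r p) (k i)) (hk : ∀ i, 1 ≤ k i)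
    (hα : ∀ i, pullback R (symDiag n.factorial (FiberProd r p)) (k i) (αstar i) = α i)
    (h0 : ∀ i, pullback R (fiberDiag r p) (k i) (α i) = 0)
    (hprod :
      (List.ofFn fun i => DirectSum.of (Cohomology R (FiberProd r p)) (k i) (α i)).prod ≠ 0) :
    (n : ℕ∞) ≤ dTC r p := by
  refine le_iInf₂ fun m ⟨s, hs⟩ => ?_
  by_contra hmn
  have hmn : m + 1 ≤ n := by
    rw [Nat.cast_le, not_le] at hmn
    exact hmn
  -- Indices are shifted by one since a probability measure has at least one atom; `m + 1 ≤ n`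
  -- ensures that these strata cover.
  let A : Fin n → Set (FiberProd r p) := fun i =>
    {x | (massSupport (s x).1.toMeasure).ncard = i + 1}
  have hAU : ⋃ i, A i = Set.univ := by
    refine Set.eq_univ_of_forall fun x => Set.mem_iUnion.2 ?_
    obtain ⟨hf, hne, hc⟩ := massSupport_finProb (s x)
    have hpos := (Set.ncard_pos hf).2 hne
    refine ⟨⟨(massSupport (s x).1.toMeasure).ncard - 1, by omega⟩, ?_⟩
    change _ = _ - 1 + 1
    omega
  refine hprod (VanishesNear.eq_zero (hAU ▸ VanishesNear.prod_ofFn fun i => ?_))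
  refine vanishesNear_of_pullback_eq_zero (hk i) ?_
  -- The reason for `n!`: one symmetric product serves all the strata.
  have hdvd : (i : ℕ) + 1 ∣ n.factorial := Nat.dvd_factorial i.1.succ_pos i.2
  have := pullback_eq_of_homotopic
    (homotopic_symDiag_comp hr hs hdvd (A := A i) fun x hx => hx) (hk i) (αstar i)
  rw [pullback_comp, pullback_comp, pullback_comp, pullback_comp, hα, h0, map_zero,
    map_zero] at this
  exact this.symm

theorem le_dTC_of_le_cupLength (p : C(E, B)) {r n : ℕ} (hr : 0 < r) (hn : 1 ≤ n)
    (R : Type w) [CommRing R]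
    (hcup : (n : ℕ∞) ≤ cupLength
      ((pullbackRing R (symDiag n.factorial (FiberProd r p))).range ∩
        (RingHom.ker (pullbackRing R (fiberDiag r p)) :
          Set (CohomologyRing R (FiberProd r p))))) :
    (n : ℕ∞) ≤ dTC r p := by
  obtain ⟨m, hnm, k, a, ha, hprod⟩ : ∃ m, n ≤ m ∧ ∃ (k : Fin m → ℕ)
      (a : ∀ i, Cohomology R (FiberProd r p) (k i)),
      (∀ i, 1 ≤ k i ∧ DirectSum.of (Cohomology R (FiberProd r p)) (k i) (a i) ∈
        ((pullbackRing R (symDiag n.factorial (FiberProd r p))).range ∩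
          (RingHom.ker (pullbackRing R (fiberDiag r p)) :
            Set (CohomologyRing R (FiberProd r p))) : Set _)) ∧
      (List.ofFn fun i => DirectSum.of (Cohomology R (FiberProd r p)) (k i) (a i)).prod ≠ 0 := by
    -- If every nonzero product had fewer than `n` factors, the supremum would be at most `n - 1`,
    -- which is below `n` because `n ≥ 1`.
    by_contra! hcon
    have hle : cupLength ((pullbackRing R (symDiag n.factorial (FiberProd r p))).range ∩
          (RingHom.ker (pullbackRing R (fiberDiag r p)) :
            Set (CohomologyRing R (FiberProd r p)))) ≤ ((n - 1 : ℕ) : ℕ∞) := by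
      refine iSup₂_le fun m ⟨k, a, ha, hprod⟩ => ?_
      rw [Nat.cast_le]
      by_contra hm
      exact hprod (hcon m (by omega) k a ha)
    have := Nat.cast_le.1 (hcup.trans hle)
    omega
  obtain ⟨l, rfl⟩ := Nat.exists_eq_add_of_le hnm
  -- The first `n` factors of a nonzero product already have nonzero product.
  rw [List.ofFn_add, List.prod_append] at hprod
  have hrange : ∀ i, ∃ b : Cohomology R (SymProd n.factorial (FiberProd r p)) (k i),
      pullback R (symDiag n.factorial (FiberProd r p)) (k i) b = a i := fun i => by
    obtain ⟨b, hb⟩ := (ha i).2.1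
    -- The induced map preserves degree, so the component of a preimage in degree `k i` is a
    -- homogeneous preimage.
    refine ⟨b (k i), ?_⟩
    rw [← pullbackRing_apply, hb, DirectSum.of_eq_same]
  choose b hb using hrange
  refine le_dTC_of_prod_ne_zero p hr R (fun i => k (i.castAdd l)) (fun i => b (i.castAdd l))
    (fun i => a (i.castAdd l)) (fun i => (ha _).1) (fun i => hb _) (fun i => ?_)
    (left_ne_zero_of_mul hprod)
  have h := (ha (i.castAdd l)).2.2
  rw [SetLike.mem_coe, RingHom.mem_ker, pullbackRing_of] at h
  exact DirectSum.of_injective _ (h.trans (map_zero _).symm)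

end LowerBound

theorem mainTheorem1 {E : Type u} {B : Type v} [MetricSpace E] [TopologicalSpace B]
    (p : C(E, B)) (hp : IsHurewiczFibration p) (r n : ℕ) (hr : 2 ≤ r) (hn : 1 ≤ n)
    (R : Type w) [CommRing R] :
    (∀ (k : Fin n → ℕ)
        (αstar : ∀ i, AlexanderSpanier.Cohomology R (SymProd n.factorial (FiberProd r p)) (k i))
        (α : ∀ i, AlexanderSpanier.Cohomology R (FiberProd r p) (k i)),
      (∀ i, 1 ≤ k i) →
      (∀ i, AlexanderSpanier.pullback R (symDiag n.factorial (FiberProd r p)) (k i) (αstar i)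
        = α i) →
      (∀ i, AlexanderSpanier.pullback R (fiberDiag r p) (k i) (α i) = 0) →
      (List.ofFn fun i =>
        DirectSum.of (AlexanderSpanier.Cohomology R (FiberProd r p)) (k i) (α i)).prod ≠ 0 →
      (n : ℕ∞) ≤ dTC r p) ∧
    ((n : ℕ∞) ≤ AlexanderSpanier.cupLength
        ((AlexanderSpanier.pullbackRing R (symDiag n.factorial (FiberProd r p))).range ∩
          (RingHom.ker (AlexanderSpanier.pullbackRing R (fiberDiag r p)) :
            Set (AlexanderSpanier.CohomologyRing R (FiberProd r p)))) →
      (n : ℕ∞) ≤ dTC r p) :=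
  ⟨fun k αstar α hk hα h0 hprod =>
      le_dTC_of_prod_ne_zero p (by omega) R k αstar α hk hα h0 hprod,
    fun hcup => le_dTC_of_le_cupLength p (by omega) hn R hcup⟩
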